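/- Let $Y$ be a separable real Banach space, $X$ a real Banach space, $T\colon Y\to X$ a compact (bounded linear) operator with dense range, and $f\colon X\to\mathbb{R}$ a convex continuous function. Then the set of all points of $Y$ at which $f\circ T$ is not Fréchet differentiable can be covered by countably many (possibly zero) d.c. (delta-convex) hypersurfaces of $Y$. Here a subset $S\subset Y$ is called a d.c. hypersurface if there are a nonzero vector $v\in Y$, a closed linear subspace $E\subset Y$ with $Y=E\oplus\mathbb{R}v$, and a function $\varphi\colon E\to\mathbb{R}$ that is the difference of two Lipschitz convex functions on $E$, such that $S=\{e+\varphi(e)v : e\in E\}$. -/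

import Mathlib

/-- `φ` is the difference of two Lipschitz convex real functions on the normed space `E`. -/
def IsLipschitzDeltaConvex {E : Type*} [NormedAddCommGroup E] [NormedSpace ℝ E]
    (φ : E → ℝ) : Prop :=
  ∃ g h : E → ℝ,
    ConvexOn ℝ Set.univ g ∧ (∃ K, LipschitzWith K g) ∧
    ConvexOn ℝ Set.univ h ∧ (∃ K, LipschitzWith K h) ∧
    ∀ x, φ x = g x - h x

/-- `S` is a d.c. (delta-convex) hypersurface of `Y`: there are a closed subspace `E` of `Y`
complementary to a line `ℝ v` (`v ≠ 0`) and a difference `φ : E → ℝ` of two Lipschitz convex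
functions such that `S = {e + φ(e) v : e ∈ E}`. -/
def IsDCHypersurface {Y : Type*} [NormedAddCommGroup Y] [NormedSpace ℝ Y] (S : Set Y) : Prop :=
  ∃ (E : Submodule ℝ Y) (v : Y) (φ : E → ℝ),
    IsClosed (E : Set Y) ∧ v ≠ 0 ∧ IsCompl E (Submodule.span ℝ {v}) ∧
    IsLipschitzDeltaConvex φ ∧
    S = Set.range fun e : E => (e : Y) + φ e • v

open Set Filter Topology

/-! Write F = f ∘ T. If F has a unique subgradient at y, Hahn–Banach bounds its one-sided
directional derivatives. Compactness of T leaves only finitely many directions to control, up to a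
small error absorbed by the local Lipschitz bound on f, so F is Fréchet differentiable at y. Each
exceptional point thus has two subgradients. They differ along a vector v of a countable dense set,
so convex combinations of them take rational slopes p < q along v with norms at most some n. For
fixed (n, v, p, q), suprema of affine minorants give F(e + tv) = g(e) + tp = h(e) + tq with g, h
convex Lipschitz; solving for t yields a d.c. hypersurface. -/

/-- `a` is a subgradient of `F` at `y`. -/
def IsSubgradientAt {Y : Type*} [NormedAddCommGroup Y] [NormedSpace ℝ Y]
    (F : Y → ℝ) (y : Y) (a : Y →L[ℝ] ℝ) : Prop :=
  ∀ z, F y + a (z - y) ≤ F z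

/-! ### Subgradients and directional derivatives -/

section Subgradient

variable {Y : Type*} [NormedAddCommGroup Y] [NormedSpace ℝ Y] {F : Y → ℝ} {y : Y}

/-- Hahn–Banach: an affine minorant of `F` on a line that touches `F` at `y` extends to an
affine minorant on the whole space. -/
theorem ConvexOn.exists_isSubgradientAt_apply_eq (hF : ConvexOn ℝ univ F) (hc : Continuous F)
    {u : Y} {d : ℝ} (h : ∀ t : ℝ, F y + t * d ≤ F (y + t • u)) :
    ∃ a : Y →L[ℝ] ℝ, a u = d ∧ IsSubgradientAt F y a := by
  have hs : Convex ℝ {p : Y × ℝ | F p.1 < p.2} := by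
    simpa using hF.convex_strict_epigraph
  have hso : IsOpen {p : Y × ℝ | F p.1 < p.2} :=
    isOpen_lt (hc.comp continuous_fst) continuous_snd
  have ht : Convex ℝ (range fun t : ℝ => (y + t • u, F y + t * d)) := by
    rintro _ ⟨s, rfl⟩ _ ⟨t, rfl⟩ α β - - hαβ
    refine ⟨α * s + β * t, ?_⟩
    obtain rfl : β = 1 - α := by linarith
    refine Prod.ext ?_ ?_
    · simp only [Prod.fst_add, Prod.smul_fst]
      module
    · simp only [Prod.snd_add, Prod.smul_snd, smul_eq_mul]
      ring
  obtain ⟨g, c, hg1, hg2⟩ := geometric_hahn_banach_open hs hso ht (by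
    rw [Set.disjoint_left]
    rintro _ hp ⟨t, rfl⟩
    exact absurd (h t) (not_le.2 hp))
  have hg : ∀ z r, g (z, r) = g (z, 0) + r * g (0, 1) := by
    intro z r
    rw [← smul_eq_mul, ← map_smul, ← map_add]
    simp
  set β := g (0, 1) with hβ
  have hline : ∀ t : ℝ, c ≤ g (y, 0) + F y * β + t * (g (u, 0) + d * β) := by
    intro t
    have h1 := hg2 _ ⟨t, rfl⟩
    have h2 : g (y + t • u, 0) = g (y, 0) + t * g (u, 0) := by
      rw [← smul_eq_mul, ← map_smul, ← map_add]
      simp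
    simp only at h1
    rw [hg, h2] at h1
    linarith
  have hβneg : β < 0 := by
    have h1 := hg1 (y, F y + 1) (by simp)
    rw [hg] at h1
    have h2 := hline 0
    linarith
  -- An affine function of t bounded below on all of ℝ has zero slope.
  have hu : g (u, 0) + d * β = 0 := by
    by_contra hne
    have h1 := hline ((c - 1 - (g (y, 0) + F y * β)) / (g (u, 0) + d * β))
    rw [div_mul_cancel₀ _ hne] at h1
    linarith
  refine ⟨(-β)⁻¹ • g.comp (ContinuousLinearMap.inl ℝ Y ℝ), ?_, fun z => ?_⟩
  · simp only [smul_apply, ContinuousLinearMap.comp_apply,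
      ContinuousLinearMap.inl_apply, smul_eq_mul]
    have : g (u, 0) = -(d * β) := by linarith
    rw [this, ← mul_neg, mul_comm, mul_inv_cancel_right₀ (neg_pos.2 hβneg).ne']
  · simp only [smul_apply, ContinuousLinearMap.comp_apply,
      ContinuousLinearMap.inl_apply, smul_eq_mul]
    have h2 : g (z - y, 0) = g (z, 0) - g (y, 0) := by
      rw [← map_sub]
      simp
    refine le_of_forall_gt fun r hr => ?_
    have h1 := hg1 (z, r) hr
    rw [hg] at h1
    have h3 := hline 0
    have h4 : (-β)⁻¹ * g (z - y, 0) < r - F y := by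
      rw [h2, inv_mul_lt_iff₀ (neg_pos.2 hβneg)]
      nlinarith
    linarith

theorem ConvexOn.exists_isSubgradientAt (hF : ConvexOn ℝ univ F) (hc : Continuous F) (y : Y) :
    ∃ a : Y →L[ℝ] ℝ, IsSubgradientAt F y a := by
  obtain ⟨a, -, ha⟩ := hF.exists_isSubgradientAt_apply_eq hc (y := y) (u := 0) (d := 0) (by simp)
  exact ⟨a, ha⟩

/-- If `F` has only one subgradient `a` at `y`, then `a` dominates the one-sided directional
derivatives of `F` at `y`. -/
theorem ConvexOn.exists_le_of_unique_isSubgradientAt (hF : ConvexOn ℝ univ F)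
    (hc : Continuous F) {a : Y →L[ℝ] ℝ} (ha : IsSubgradientAt F y a)
    (huniq : ∀ b, IsSubgradientAt F y b → b = a) (u : Y) {ε : ℝ} (hε : 0 < ε) :
    ∃ δ > 0, ∀ s : ℝ, 0 ≤ s → s ≤ δ → F (y + s • u) ≤ F y + s * (a u + ε) := by
  -- Otherwise the line of slope `a u + ε` lies below F: by assumption for t > 0, through `a` for t
  -- ≤ 0. It extends to a second subgradient.
  obtain ⟨δ, hδ, hle⟩ : ∃ δ > 0, F (y + δ • u) ≤ F y + δ * (a u + ε) := by
    by_contra! hcon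
    obtain ⟨b, hbu, hb⟩ := hF.exists_isSubgradientAt_apply_eq hc (y := y) (u := u)
      (d := a u + ε) fun t => by
        rcases lt_or_ge 0 t with ht | ht
        · exact (hcon t ht).le
        · have h1 := ha (y + t • u)
          simp only [add_sub_cancel_left, map_smul, smul_eq_mul] at h1
          nlinarith
    rw [huniq b hb] at hbu
    linarith
  refine ⟨δ, hδ, fun s hs hsδ => ?_⟩
  have h0 : 0 ≤ s / δ := by positivity
  have h1 : s / δ ≤ 1 := (div_le_one hδ).2 hsδ
  have h2 := hF.2 (mem_univ y) (mem_univ (y + δ • u)) (sub_nonneg.2 h1) h0 (by ring)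
  have h3 : (1 - s / δ) • y + (s / δ) • (y + δ • u) = y + s • u := by
    have : s • u = (s / δ) • δ • u := by rw [smul_smul, div_mul_cancel₀ _ hδ.ne']
    rw [this]
    module
  rw [h3] at h2
  simp only [smul_eq_mul] at h2
  have h4 := mul_le_mul_of_nonneg_left hle h0
  have h5 : s / δ * (F y + δ * (a u + ε)) = s / δ * F y + s * (a u + ε) := by
    field_simp
  linarith

end Subgradient

/-! ### Fréchet differentiability from compactness -/

section Frechet

variable {Y X : Type*} [NormedAddCommGroup Y] [NormedSpace ℝ Y]
  [NormedAddCommGroup X] [NormedSpace ℝ X]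

/-- A composition of a convex continuous function with a compact operator is Fréchet
differentiable wherever its subgradient is unique. -/
theorem ConvexOn.hasFDerivAt_comp_of_unique_isSubgradientAt {f : X → ℝ}
    (hf : ConvexOn ℝ univ f) (hc : Continuous f) (T : Y →L[ℝ] X) (hT : IsCompactOperator T)
    {y : Y} {a : Y →L[ℝ] ℝ} (ha : IsSubgradientAt (f ∘ T) y a)
    (huniq : ∀ b, IsSubgradientAt (f ∘ T) y b → b = a) : HasFDerivAt (f ∘ T) a y := by
  have hF : ConvexOn ℝ univ (f ∘ T) := by
    simpa using hf.comp_linearMap (T : Y →ₗ[ℝ] X)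
  have hFc : Continuous (f ∘ T) := hc.comp T.continuous
  obtain ⟨K, r, hr, hK⟩ : ∃ K : NNReal, ∃ r > 0, LipschitzOnWith K f (Metric.ball (T y) r) := by
    obtain ⟨K, t, ht, hK⟩ := (hf.locallyLipschitzOn_iff_continuousOn isOpen_univ).2
      hc.continuousOn (mem_univ (T y))
    rw [nhdsWithin_univ] at ht
    obtain ⟨r, hr, hrt⟩ := Metric.mem_nhds_iff.1 ht
    exact ⟨K, r, hr, hK.mono hrt⟩
  have hlip : ∀ x x' : X, ‖x‖ < r → ‖x'‖ < r → f (T y + x) - f (T y + x') ≤ K * ‖x - x'‖ := by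
    intro x x' hx hx'
    have := hK.dist_le_mul (T y + x) (by simpa using hx) (T y + x') (by simpa using hx')
    rw [dist_add_left, dist_eq_norm x x', Real.dist_eq] at this
    exact (le_abs_self _).trans this
  -- The subgradient inherits the Lipschitz bound of f through T, so closeness of `T u` and `T w`
  -- forces closeness of `a u` and `a w`.
  have hale : ∀ w : Y, a w ≤ K * ‖T w‖ := by
    intro w
    obtain ⟨t, ht, htr⟩ : ∃ t > 0, t * ‖T w‖ < r := by
      refine ⟨r / (‖T w‖ + 1), by positivity, ?_⟩
      rw [div_mul_eq_mul_div, div_lt_iff₀ (by positivity)]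
      nlinarith
    have h1 := ha (y + t • w)
    have h2 := hlip (t • T w) 0 (by rwa [norm_smul, Real.norm_of_nonneg ht.le]) (by simpa using hr)
    simp only [add_sub_cancel_left, map_smul, smul_eq_mul, Function.comp_apply, map_add,
      add_zero, sub_zero, norm_smul, Real.norm_of_nonneg ht.le] at h1 h2
    have : t * a w ≤ t * (K * ‖T w‖) := by linarith
    exact le_of_mul_le_mul_left this ht
  rw [hasFDerivAt_iff_isLittleO_nhds_zero, Asymptotics.isLittleO_iff]
  intro ε hε
  -- Replacing h by the net direction costs K * η in f and K * η in `a`; the directional estimate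
  -- costs η, all times ‖h‖.
  set η : ℝ := ε / (2 * K + 1) with hη_def
  have hη : 0 < η := by positivity
  have hηε : (2 * K + 1) * η = ε := by
    rw [hη_def]
    field_simp
  have htb : TotallyBounded (T '' Metric.closedBall 0 1) :=
    ((IsCompactOperator.isCompact_closure_image_closedBall (f := (T : Y →ₗ[ℝ] X)) hT
      1).totallyBounded).subset subset_closure
  obtain ⟨N, hNsub, hNfin, hN⟩ := Metric.finite_approx_of_totallyBounded htb η hη
  have hnet : ∀ x ∈ N, ∀ᶠ s in 𝓝[≥] (0 : ℝ), ‖s • x‖ < r ∧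
      ∃ u, T u = x ∧ f (T y + s • x) ≤ f (T y) + s * (a u + η) := by
    intro x hx
    obtain ⟨u, -, rfl⟩ := hNsub hx
    obtain ⟨δ, hδ, hle⟩ := hF.exists_le_of_unique_isSubgradientAt hFc ha huniq u hη
    have hcont : Tendsto (fun s : ℝ => ‖s • T u‖) (𝓝[≥] 0) (𝓝 0) := by
      have : Continuous fun s : ℝ => ‖s • T u‖ := by fun_prop
      simpa using (this.tendsto 0).mono_left nhdsWithin_le_nhds
    filter_upwards [hcont.eventually_lt_const hr, self_mem_nhdsWithin,
      nhdsWithin_le_nhds (Iic_mem_nhds hδ)] with s hs1 hs0 hsδ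
    exact ⟨hs1, u, rfl, by simpa using hle s hs0 hsδ⟩
  have hnorm : Tendsto (fun h : Y => ‖h‖) (𝓝 0) (𝓝[≥] 0) :=
    tendsto_nhdsWithin_iff.2 ⟨tendsto_norm_zero, Eventually.of_forall fun h => norm_nonneg h⟩
  have hTnorm : Tendsto (fun h : Y => ‖T h‖) (𝓝 0) (𝓝 0) := by
    have : Continuous fun h : Y => ‖T h‖ := by fun_prop
    simpa using this.tendsto 0
  filter_upwards [hnorm.eventually ((eventually_all_finite hNfin).2 hnet),
    hTnorm.eventually_lt_const hr] with h hh hTh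
  have hlow : 0 ≤ (f ∘ T) (y + h) - (f ∘ T) y - a h := by
    have := ha (y + h)
    rw [add_sub_cancel_left] at this
    linarith
  rw [Real.norm_of_nonneg hlow]
  rcases eq_or_ne h 0 with rfl | hne
  · simp
  have hs : 0 < ‖h‖ := norm_pos_iff.2 hne
  set s := ‖h‖ with hs_def
  set w := s⁻¹ • h with hw
  have hsw : s • w = h := smul_inv_smul₀ hs.ne' h
  have hwmem : T w ∈ T '' Metric.closedBall 0 1 := by
    refine ⟨w, ?_, rfl⟩
    rw [mem_closedBall_zero_iff, hw, norm_smul, norm_inv, Real.norm_of_nonneg hs.le,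
      inv_mul_cancel₀ hs.ne']
  obtain ⟨x, hxN, hxw⟩ := mem_iUnion₂.1 (hN hwmem)
  rw [mem_ball_iff_norm] at hxw
  obtain ⟨hsx, u, rfl, hu⟩ := hh x hxN
  have h1 := hlip (T h) (s • T u) hTh hsx
  have h2 : ‖T h - s • T u‖ ≤ s * η := by
    rw [← hsw, map_smul, ← smul_sub, norm_smul, Real.norm_of_nonneg hs.le]
    exact mul_le_mul_of_nonneg_left hxw.le hs.le
  have h3 : a u ≤ a w + K * η := by
    have h4 := hale (u - w)
    rw [map_sub, map_sub, norm_sub_rev] at h4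
    have h5 := mul_le_mul_of_nonneg_left hxw.le (NNReal.coe_nonneg K)
    linarith
  have h4 := mul_le_mul_of_nonneg_left h3 hs.le
  have h5 : s * a w = a h := by rw [← smul_eq_mul, ← map_smul, hsw]
  have h6 := mul_le_mul_of_nonneg_left h2 (NNReal.coe_nonneg K)
  simp only [Function.comp_apply, map_add]
  rw [← hηε]
  linarith

end Frechet

/-! ### Hypersurfaces from pairs of slopes -/

section DeltaConvex

variable {Y : Type*} [NormedAddCommGroup Y] [NormedSpace ℝ Y]

theorem convexOn_ciSup_affine {ι : Type*} [Nonempty ι] (a : ι → Y →L[ℝ] ℝ) (r : ι → ℝ)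
    (hb : ∀ z, BddAbove (range fun i => a i z + r i)) :
    ConvexOn ℝ univ fun z => ⨆ i, (a i z + r i) := by
  refine ⟨convex_univ, fun z _ w _ α β hα hβ hαβ => ciSup_le fun i => ?_⟩
  have h1 := mul_le_mul_of_nonneg_left (le_ciSup (hb z) i) hα
  have h2 := mul_le_mul_of_nonneg_left (le_ciSup (hb w) i) hβ
  simp only [map_add, map_smul, smul_eq_mul]
  obtain rfl : β = 1 - α := by linarith
  linarith

theorem lipschitzWith_ciSup_affine {ι : Type*} [Nonempty ι] (a : ι → Y →L[ℝ] ℝ) (r : ι → ℝ)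
    (hb : ∀ z, BddAbove (range fun i => a i z + r i)) {K : NNReal} (hK : ∀ i, ‖a i‖ ≤ K) :
    LipschitzWith K fun z => ⨆ i, (a i z + r i) := by
  refine LipschitzWith.of_le_add_mul K fun z w => ciSup_le fun i => ?_
  have h1 : a i w + r i ≤ ⨆ j, (a j w + r j) := le_ciSup (hb w) i
  have h2 : a i (z - w) ≤ K * dist z w := by
    rw [dist_eq_norm]
    exact (le_abs_self _).trans ((a i).le_of_opNorm_le (hK i) _)
  rw [map_sub] at h2
  linarith

/-- The affine minorants of `F` with linear part of norm at most `K` and slope `c` along `v`. -/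
def boundedMinorants (F : Y → ℝ) (K : NNReal) (v : Y) (c : ℝ) : Set ((Y →L[ℝ] ℝ) × ℝ) :=
  {p | ‖p.1‖ ≤ K ∧ p.1 v = c ∧ ∀ z, p.1 z + p.2 ≤ F z}

/-- The points with a subgradient of norm at most `K` and slope `c` along `v`. -/
def pointsWithSlope (F : Y → ℝ) (K : NNReal) (v : Y) (c : ℝ) : Set Y :=
  {y | ∃ a : Y →L[ℝ] ℝ, IsSubgradientAt F y a ∧ ‖a‖ ≤ K ∧ a v = c}

/-- Points with a subgradient of slope `c` along `v` all satisfy `F y = h e + t * c` with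
`y = e + t v` and a fixed Lipschitz convex function `h`. -/
theorem exists_convex_lipschitz_eq_of_mem_pointsWithSlope {F : Y → ℝ} {K : NNReal} {v : Y} {c : ℝ}
    (hne : (pointsWithSlope F K v c).Nonempty) :
    ∃ h : Y → ℝ, ConvexOn ℝ univ h ∧ LipschitzWith K h ∧
      ∀ (e : Y) (t : ℝ), e + t • v ∈ pointsWithSlope F K v c → F (e + t • v) = h e + t * c := by
  have key : ∀ y a, IsSubgradientAt F y a → ‖a‖ ≤ K → a v = c →
      (a, F y - a y) ∈ boundedMinorants F K v c := by
    intro y a ha haK hav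
    refine ⟨haK, hav, fun z => ?_⟩
    have := ha z
    rw [map_sub] at this
    simp only
    linarith
  have : Nonempty (boundedMinorants F K v c) := by
    obtain ⟨y, a, ha, haK, hav⟩ := hne
    exact ⟨⟨_, key y a ha haK hav⟩⟩
  have hb : ∀ z, BddAbove (range fun p : boundedMinorants F K v c => p.1.1 z + p.1.2) := by
    rintro z
    refine ⟨F z, ?_⟩
    rintro _ ⟨p, rfl⟩
    exact p.2.2.2 z
  refine ⟨fun z => ⨆ p : boundedMinorants F K v c, (p.1.1 z + p.1.2),
    convexOn_ciSup_affine _ _ hb, lipschitzWith_ciSup_affine _ _ hb fun p => p.2.1, ?_⟩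
  rintro e t ⟨a, ha, haK, hav⟩
  apply le_antisymm
  · have h1 := le_ciSup (hb e) ⟨_, key _ a ha haK hav⟩
    simp only [map_add, map_smul, smul_eq_mul, hav] at h1
    linarith
  · rw [← le_sub_iff_add_le]
    refine ciSup_le fun p => ?_
    have h1 := p.2.2.2 (e + t • v)
    simp only [map_add, map_smul, smul_eq_mul, p.2.2.1] at h1
    linarith

/-- Subtracting the two formulas for F gives t = (g e - h e) / (d - c). A common point supplies the
functional `b - a`, nonzero at `v`, whose kernel serves as E. -/
theorem exists_isDCHypersurface_of_slopes {F : Y → ℝ} {K : NNReal} {v : Y} {c d : ℝ} (hcd : c < d)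
    (hne : (pointsWithSlope F K v c ∩ pointsWithSlope F K v d).Nonempty) :
    ∃ S, IsDCHypersurface S ∧ pointsWithSlope F K v c ∩ pointsWithSlope F K v d ⊆ S := by
  obtain ⟨g, hg, hgK, hgF⟩ := exists_convex_lipschitz_eq_of_mem_pointsWithSlope hne.left
  obtain ⟨h, hh, hhK, hhF⟩ := exists_convex_lipschitz_eq_of_mem_pointsWithSlope hne.right
  obtain ⟨y, ⟨a, -, -, hav⟩, b, -, -, hbv⟩ := hne
  set ℓ : Y →L[ℝ] ℝ := b - a with hℓ
  have hℓv : ℓ v ≠ 0 := by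
    simp only [hℓ, sub_apply, hav, hbv]
    exact (sub_pos.2 hcd).ne'
  have hv : v ≠ 0 := by
    rintro rfl
    simp at hℓv
  have hpos : 0 < (d - c)⁻¹ := inv_pos.2 (sub_pos.2 hcd)
  have hconv : ∀ k : Y → ℝ, ConvexOn ℝ univ k →
      ConvexOn ℝ univ fun e : LinearMap.ker (ℓ : Y →ₗ[ℝ] ℝ) => (d - c)⁻¹ * k e := by
    intro k hk
    simpa [Function.comp_def] using
      (hk.comp_linearMap (LinearMap.ker (ℓ : Y →ₗ[ℝ] ℝ)).subtype).smul hpos.le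
  have hlip : ∀ k : Y → ℝ, LipschitzWith K k → ∃ L, LipschitzWith L
      fun e : LinearMap.ker (ℓ : Y →ₗ[ℝ] ℝ) => (d - c)⁻¹ * k e := by
    intro k hk
    exact ⟨_, (lipschitzWith_smul (d - c)⁻¹).comp (hk.comp (LipschitzWith.subtype_val _))⟩
  refine ⟨_, ⟨LinearMap.ker (ℓ : Y →ₗ[ℝ] ℝ), v, fun e => (d - c)⁻¹ * g e - (d - c)⁻¹ * h e,
    ℓ.isClosed_ker, hv, ?_, ⟨_, _, hconv g hg, hlip g hgK, hconv h hh, hlip h hhK, fun _ => rfl⟩,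
    rfl⟩, ?_⟩
  · refine isCompl_iff.2 ⟨?_, ?_⟩
    · rw [Submodule.disjoint_def]
      intro x hx hxv
      obtain ⟨t, rfl⟩ := Submodule.mem_span_singleton.1 hxv
      have : t * ℓ v = 0 := by simpa using hx
      rw [(mul_eq_zero.1 this).resolve_right hℓv, zero_smul]
    · rw [Submodule.codisjoint_iff_exists_add_eq]
      intro z
      refine ⟨z - (ℓ z / ℓ v) • v, (ℓ z / ℓ v) • v, ?_,
        Submodule.smul_mem _ _ (Submodule.mem_span_singleton_self v), by simp⟩
      simp [hℓv]
  · rintro z ⟨hzc, hzd⟩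
    set t := ℓ z / ℓ v with ht
    set e := z - t • v with he
    have hz : z = e + t • v := by simp [he]
    have heker : e ∈ LinearMap.ker (ℓ : Y →ₗ[ℝ] ℝ) := by simp [he, ht, hℓv]
    rw [hz] at hzc hzd
    have h1 := hgF e t hzc
    have h2 := hhF e t hzd
    refine ⟨⟨e, heker⟩, ?_⟩
    simp only
    have h3 : (d - c)⁻¹ * g e - (d - c)⁻¹ * h e = t := by
      rw [← mul_sub, inv_mul_eq_iff_eq_mul₀ (sub_pos.2 hcd).ne']
      linarith
    rw [h3, ← hz]

end DeltaConvex

/-! ### Countable cover by rational slopes -/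

section Cover

variable {Y : Type*} [NormedAddCommGroup Y] [NormedSpace ℝ Y] {F : Y → ℝ} {y : Y}

theorem mem_pointsWithSlope_of_between {a b : Y →L[ℝ] ℝ} (ha : IsSubgradientAt F y a)
    (hb : IsSubgradientAt F y b) {K : NNReal} (haK : ‖a‖ ≤ K) (hbK : ‖b‖ ≤ K) {v : Y} {c : ℝ}
    (hac : a v < c) (hcb : c < b v) : y ∈ pointsWithSlope F K v c := by
  have hpos : 0 < b v - a v := by linarith
  set s := (c - a v) / (b v - a v) with hs
  have hs0 : 0 ≤ s := div_nonneg (by linarith) hpos.le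
  have hs1 : 0 ≤ 1 - s := sub_nonneg.2 ((div_le_one hpos).2 (by linarith))
  refine ⟨(1 - s) • a + s • b, fun z => ?_, ?_, ?_⟩
  · have h1 := mul_le_mul_of_nonneg_left (ha z) hs1
    have h2 := mul_le_mul_of_nonneg_left (hb z) hs0
    simp only [add_apply, smul_apply, smul_eq_mul]
    linarith
  · refine (norm_add_le _ _).trans ?_
    rw [norm_smul, norm_smul, Real.norm_of_nonneg hs0, Real.norm_of_nonneg hs1]
    nlinarith
  · simp only [add_apply, smul_apply, smul_eq_mul]
    have : s * (b v - a v) = c - a v := div_mul_cancel₀ _ hpos.ne'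
    linarith

theorem exists_mem_pointsWithSlope_of_ne {u : ℕ → Y} (hu : DenseRange u) {a b : Y →L[ℝ] ℝ}
    (ha : IsSubgradientAt F y a) (hb : IsSubgradientAt F y b) (hab : a ≠ b) :
    ∃ (n k : ℕ) (p q : ℚ), p < q ∧
      y ∈ pointsWithSlope F n (u k) p ∩ pointsWithSlope F n (u k) q := by
  obtain ⟨k, hk⟩ : ∃ k, a (u k) ≠ b (u k) := by
    by_contra! hcon
    exact hab (ContinuousLinearMap.coeFn_injective
      (hu.equalizer a.continuous b.continuous (funext hcon)))
  wlog hlt : a (u k) < b (u k) generalizing a b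
  · exact this hb ha hab.symm hk.symm (lt_of_le_of_ne (not_lt.1 hlt) hk.symm)
  obtain ⟨p, hp1, hp2⟩ := exists_rat_btwn hlt
  obtain ⟨q, hq1, hq2⟩ := exists_rat_btwn hp2
  obtain ⟨n, hn⟩ := exists_nat_ge (max ‖a‖ ‖b‖)
  have hna : ‖a‖ ≤ ((n : NNReal) : ℝ) := by simpa using (le_max_left _ _).trans hn
  have hnb : ‖b‖ ≤ ((n : NNReal) : ℝ) := by simpa using (le_max_right _ _).trans hn
  exact ⟨n, k, p, q, by exact_mod_cast hq1, mem_pointsWithSlope_of_between ha hb hna hnb hp1 hp2,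
    mem_pointsWithSlope_of_between ha hb hna hnb (hp1.trans hq1) hq2⟩

end Cover

theorem mainTheorem3 {Y X : Type*}
    [NormedAddCommGroup Y] [NormedSpace ℝ Y] [CompleteSpace Y]
    [TopologicalSpace.SeparableSpace Y]
    [NormedAddCommGroup X] [NormedSpace ℝ X] [CompleteSpace X]
    (T : Y →L[ℝ] X) (hT : IsCompactOperator T) (hTdense : DenseRange T)
    (f : X → ℝ) (hfconv : ConvexOn ℝ Set.univ f) (hfcont : Continuous f) :
    ∃ 𝒮 : Set (Set Y), 𝒮.Countable ∧ (∀ S ∈ 𝒮, IsDCHypersurface S) ∧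
      {y : Y | ¬ DifferentiableAt ℝ (f ∘ T) y} ⊆ ⋃₀ 𝒮 := by
  have hF : ConvexOn ℝ univ (f ∘ T) := by
    simpa using hfconv.comp_linearMap (T : Y →ₗ[ℝ] X)
  have hFc : Continuous (f ∘ T) := hfcont.comp T.continuous
  let A : ℕ × ℕ × ℚ × ℚ → Set Y := fun i =>
    pointsWithSlope (f ∘ T) i.1 (TopologicalSpace.denseSeq Y i.2.1) i.2.2.1 ∩
      pointsWithSlope (f ∘ T) i.1 (TopologicalSpace.denseSeq Y i.2.1) i.2.2.2
  -- Empty pieces are dropped: the complement of v is built from subgradients at a point of the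
  -- piece.
  let I : Set (ℕ × ℕ × ℚ × ℚ) := {i | i.2.2.1 < i.2.2.2 ∧ (A i).Nonempty}
  have hI : ∀ i : I, ∃ S, IsDCHypersurface S ∧ A i ⊆ S := fun i =>
    exists_isDCHypersurface_of_slopes (by exact_mod_cast i.2.1) i.2.2
  choose S hS hAS using hI
  refine ⟨range S, countable_range S, ?_, fun y hy => ?_⟩
  · rintro _ ⟨i, rfl⟩
    exact hS i
  · obtain ⟨a, ha⟩ := hF.exists_isSubgradientAt hFc y
    obtain ⟨b, hb, hba⟩ : ∃ b, IsSubgradientAt (f ∘ T) y b ∧ b ≠ a := by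
      by_contra! huniq
      exact hy (hfconv.hasFDerivAt_comp_of_unique_isSubgradientAt hfcont T hT ha
        huniq).differentiableAt
    obtain ⟨n, k, p, q, hpq, hmem⟩ :=
      exists_mem_pointsWithSlope_of_ne (TopologicalSpace.denseRange_denseSeq Y) hb ha hba
    exact ⟨_, ⟨⟨(n, k, p, q), hpq, y, hmem⟩, rfl⟩, hAS _ hmem⟩
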